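/- All Banach spaces are complex. A Banach space $E$ has the diameter two property (D2P) if every nonempty relatively weakly open subset of its closed unit ball $B_E$ has diameter $2$. For a Hausdorff space $\Omega$ and a Banach space $X$, let $C_b(\Omega,X)$ be the space of bounded continuous functions $\Omega\to X$ with the supremum norm, and $C_b(\Omega)=C_b(\Omega,\mathbb C)$. A function algebra on $\Omega$ is a closed subalgebra of $C_b(\Omega)$ that contains the constants and separates the points of $\Omega$. An $X$-valued function space over a function algebra on $\Omega$ is a closed subspace $A(\Omega,X)$ of $C_b(\Omega,X)$ such that (i) the base algebra $A:=\{x^*\circ f: f\in A(\Omega,X),\ x^*\in X^*\}$ is a function algebra on $\Omega$, and (ii) $\varphi f\in A(\Omega,X)$ for all $\varphi\in A$ and $f\in A(\Omega,X)$, where $(\varphi f)(t)=\varphi(t)f(t)$. (1) Let $X$ be a Banach space and let $A(\Omega,X)$ be an $X$-valued function space over a function algebra $A$ on a Hausdorff space $\Omega$. If the base algebra $A$ is infinite dimensional, then $A(\Omega,X)$ has the D2P. (2) Let $X$ and $Y$ be nontrivial Banach spaces. Let $A_b(B_X,Y)$ be the subspace of $C_b(B_X,Y)$ of all functions that are holomorphic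 on the interior of $B_X$, and let $A_u(B_X,Y)$ be the subspace of $A_b(B_X,Y)$ of all functions that are uniformly continuous on $B_X$. Then $C_b(B_X,Y)$, $A_b(B_X,Y)$ and $A_u(B_X,Y)$ have the D2P. -/

import Mathlib

open scoped BoundedContinuousFunction

/-- The diameter two property of a complex normed space `E`: every nonempty relatively weakly open
subset of the closed unit ball of `E` has diameter two. -/
def HasD2P (E : Type*) [NormedAddCommGroup E] [NormedSpace ℂ E] : Prop :=
  ∀ U : Set (WeakSpace ℂ E), IsOpen U →
    (toWeakSpace ℂ E ⁻¹' U ∩ Metric.closedBall (0 : E) 1).Nonempty →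
    Metric.diam (toWeakSpace ℂ E ⁻¹' U ∩ Metric.closedBall (0 : E) 1) = 2

/-- A function algebra on `Ω`: a closed subalgebra of `C_b(Ω)` which contains the constants (as every
`Subalgebra` does) and separates the points of `Ω`. -/
structure IsFunctionAlgebra {Ω : Type*} [TopologicalSpace Ω] (A : Subalgebra ℂ (Ω →ᵇ ℂ)) :
    Prop where
  isClosed : IsClosed (A : Set (Ω →ᵇ ℂ))
  separates : ∀ s t : Ω, s ≠ t → ∃ f ∈ A, f s ≠ f t

/-- The set `{x* ∘ f : f ∈ S, x* ∈ X*}` of scalar functions. -/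
def baseSet {Ω X : Type*} [TopologicalSpace Ω] [NormedAddCommGroup X] [NormedSpace ℂ X]
    (S : Submodule ℂ (Ω →ᵇ X)) : Set (Ω →ᵇ ℂ) :=
  {g | ∃ f ∈ S, ∃ φ : StrongDual ℂ X, ∀ t, g t = φ (f t)}

/-- `S` is an `X`-valued function space on `Ω` over the function algebra `A`. -/
structure IsFunctionSpaceOver {Ω X : Type*} [TopologicalSpace Ω] [NormedAddCommGroup X]
    [NormedSpace ℂ X] (S : Submodule ℂ (Ω →ᵇ X)) (A : Subalgebra ℂ (Ω →ᵇ ℂ)) : Prop where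
  isClosed : IsClosed (S : Set (Ω →ᵇ X))
  base_eq : (A : Set (Ω →ᵇ ℂ)) = baseSet S
  isFunctionAlgebra : IsFunctionAlgebra A
  smul_mem : ∀ φ ∈ A, ∀ f ∈ S, φ • f ∈ S

/-- The closed unit ball `B_X` as a (metric) space. -/
abbrev UnitBall (X : Type*) [NormedAddCommGroup X] : Type _ := Metric.closedBall (0 : X) 1

/-- `f : B_X → Y` is holomorphic (complex Fréchet differentiable) on the interior of `B_X`. -/
def HolomorphicInside {X Y : Type*} [NormedAddCommGroup X] [NormedSpace ℂ X]
    [NormedAddCommGroup Y] [NormedSpace ℂ Y] (f : UnitBall X → Y) : Prop :=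
  ∃ F : X → Y, DifferentiableOn ℂ F (interior (Metric.closedBall (0 : X) 1)) ∧
    ∀ x : UnitBall X, (x : X) ∈ interior (Metric.closedBall (0 : X) 1) → f x = F x

/-- `A_b(B_X, Y)`: the bounded continuous functions `B_X → Y` that are holomorphic on the interior
of `B_X`, with the supremum norm. -/
def HolBdd (X Y : Type*) [NormedAddCommGroup X] [NormedSpace ℂ X]
    [NormedAddCommGroup Y] [NormedSpace ℂ Y] : Submodule ℂ (UnitBall X →ᵇ Y) where
  carrier := {f | HolomorphicInside f}
  zero_mem' := ⟨0, differentiableOn_const 0, fun _ _ => rfl⟩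
  add_mem' := by
    rintro f g ⟨F, hF, hf⟩ ⟨G, hG, hg⟩
    exact ⟨F + G, hF.add hG, fun x hx => by simp [hf x hx, hg x hx]⟩
  smul_mem' := by
    rintro c f ⟨F, hF, hf⟩
    exact ⟨c • F, hF.const_smul c, fun x hx => by simp [hf x hx]⟩

/-- `A_u(B_X, Y)`: the functions in `A_b(B_X, Y)` that are uniformly continuous on `B_X`. -/
def HolUnif (X Y : Type*) [NormedAddCommGroup X] [NormedSpace ℂ X]
    [NormedAddCommGroup Y] [NormedSpace ℂ Y] : Submodule ℂ (UnitBall X →ᵇ Y) where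
  carrier := {f | f ∈ HolBdd X Y ∧ UniformContinuous f}
  zero_mem' := ⟨(HolBdd X Y).zero_mem, uniformContinuous_const⟩
  add_mem' := by
    rintro f g ⟨hf, hf'⟩ ⟨hg, hg'⟩
    exact ⟨(HolBdd X Y).add_mem hf hg, hf'.add hg'⟩
  smul_mem' := by
    rintro c f ⟨hf, hf'⟩
    exact ⟨(HolBdd X Y).smul_mem c hf, hf'.const_smul c⟩

/-! The Gelfand transform turns `A` into an algebra of continuous functions on the compact character
space of `C_b(Ω)`. Take a minimal closed boundary `K` there. It is infinite because `A` is infinite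
dimensional, so there are open sets `V n` that meet `K` and are disjoint on it. Minimality gives `φ
n` in `A`, nearly supported on `V n` within `K`, with `|φ n| + |1 - φ n|` nearly at most `1` on `K`
(`exists_urysohn`), and then a vector `h n` for which `φ n • h n` has norm close to `1`
(`exists_multiplier_and_vector`).

For `f` in the unit ball, the vectors `f - φ n • f ± φ n • h n` have norm nearly at most `1`. They
tend weakly to `f`, since bounded sequences with almost disjoint supports are weakly null
(`tendsto_zero_of_disjoint_supports`), and they are almost `2` apart. Both parts of the theorem are
instances of `hasD2P_of_module`. -/

/-- `K` is a closed boundary for `A`: every member of `A` attains its norm on `K`. -/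
def IsClosedBoundary {Z : Type*} [TopologicalSpace Z] [CompactSpace Z]
    (A : Subalgebra ℂ C(Z, ℂ)) (K : Set Z) : Prop :=
  IsClosed K ∧ ∀ a ∈ A, ∃ z ∈ K, ‖a z‖ = ‖a‖

/-! ### Minimal closed boundaries and peaking functions -/

section Boundary

variable {Z : Type*} [TopologicalSpace Z] [CompactSpace Z] {A : Subalgebra ℂ C(Z, ℂ)} {K : Set Z}

/-- Zorn's lemma: along a chain of boundaries, the closed sets where a fixed `a` attains its norm
are nested and nonempty, so by compactness they have a common point. -/
lemma exists_minimal_isClosedBoundary [Nonempty Z] (A : Subalgebra ℂ C(Z, ℂ)) :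
    ∃ K, Minimal (IsClosedBoundary A) K := by
  have huniv : IsClosedBoundary A Set.univ := by
    refine ⟨isClosed_univ, fun a _ => ?_⟩
    obtain ⟨z, -, hz⟩ := isCompact_univ.exists_isMaxOn Set.univ_nonempty
      (a.continuous.norm.continuousOn)
    refine ⟨z, Set.mem_univ z, le_antisymm (a.norm_coe_le_norm z) ?_⟩
    exact (ContinuousMap.norm_le _ (norm_nonneg _)).2 fun x => hz (Set.mem_univ x)
  refine zorn_superset {K | IsClosedBoundary A K} fun c hc hchain => ?_
  rcases c.eq_empty_or_nonempty with rfl | hne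
  · exact ⟨Set.univ, huniv, by simp⟩
  refine ⟨⋂₀ c, ⟨isClosed_sInter fun K hK => (hc hK).1, fun a ha => ?_⟩,
    fun s hs => Set.sInter_subset_of_mem hs⟩
  have hcl : IsClosed {z | ‖a z‖ = ‖a‖} := isClosed_eq a.continuous.norm continuous_const
  have : Nonempty c := hne.to_subtype
  obtain ⟨z, hz⟩ := IsCompact.nonempty_iInter_of_directed_nonempty_isCompact_isClosed
    (fun K : c => (K : Set Z) ∩ {z | ‖a z‖ = ‖a‖})
    (by
      intro K L
      rcases hchain.total K.2 L.2 with h | h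
      · exact ⟨K, subset_rfl, Set.inter_subset_inter_left _ h⟩
      · exact ⟨L, Set.inter_subset_inter_left _ h, subset_rfl⟩)
    (fun K => (hc K.2).2 a ha)
    (fun K => ((hc K.2).1.inter hcl).isCompact)
    (fun K => (hc K.2).1.inter hcl)
  rw [Set.mem_iInter] at hz
  exact ⟨z, Set.mem_sInter.2 fun K hK => (hz ⟨K, hK⟩).1, (hz ⟨_, hne.some_mem⟩).2⟩

lemma exists_norm_lt_of_minimal (hK : Minimal (IsClosedBoundary A) K) {V : Set Z} (hV : IsOpen V)
    (hKV : (K ∩ V).Nonempty) : ∃ a ∈ A, ∀ z ∈ K \ V, ‖a z‖ < ‖a‖ := by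
  by_contra! h
  have hb : IsClosedBoundary A (K \ V) := ⟨hK.prop.1.sdiff hV, fun a ha => by
    obtain ⟨z, hz, hz'⟩ := h a ha
    exact ⟨z, hz, le_antisymm (a.norm_coe_le_norm z) hz'⟩⟩
  obtain ⟨z, hzK, hzV⟩ := hKV
  exact (hK.le_of_le hb Set.sdiff_subset hzK).2 hzV

/-- By minimality some `a` in `A` does not attain its norm on `K \ V`. Dividing by its value at a
norming point in `K` and taking a high power makes it small on the compact set `K \ V`. -/
lemma exists_peak (hK : Minimal (IsClosedBoundary A) K) {V : Set Z} (hV : IsOpen V)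
    (hKV : (K ∩ V).Nonempty) {ε : ℝ} (hε : 0 < ε) :
    ∃ a ∈ A, (∀ z ∈ K, ‖a z‖ ≤ 1) ∧ (∀ z ∈ K \ V, ‖a z‖ ≤ ε) ∧ ∃ z ∈ K ∩ V, a z = 1 := by
  rcases (K \ V).eq_empty_or_nonempty with he | hne
  · exact ⟨1, A.one_mem, by simp, by simp [he], hKV.imp fun z hz => ⟨hz, rfl⟩⟩
  obtain ⟨a, ha, hlt⟩ := exists_norm_lt_of_minimal hK hV hKV
  obtain ⟨z₀, hz₀, hz₀'⟩ := hK.prop.2 a ha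
  have hpos : 0 < ‖a‖ := (norm_nonneg _).trans_lt (hlt _ hne.some_mem)
  have hz₀V : z₀ ∈ V := by
    by_contra h
    exact (hlt z₀ ⟨hz₀, h⟩).ne hz₀'
  obtain ⟨z₁, hz₁, hmax⟩ := (hK.prop.1.sdiff hV).isCompact.exists_isMaxOn hne
    (a.continuous.norm.continuousOn)
  have h1 : ‖a z₁‖ / ‖a‖ < 1 := (div_lt_one hpos).2 (hlt z₁ hz₁)
  obtain ⟨n, hn⟩ := exists_pow_lt_of_lt_one hε h1
  have hne0 : a z₀ ≠ 0 := norm_pos_iff.1 (hz₀'.symm ▸ hpos)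
  have hval : ∀ z, ‖(((a z₀)⁻¹ • a) ^ n) z‖ = (‖a z‖ / ‖a‖) ^ n := fun z => by
    simp [norm_inv, hz₀', div_eq_inv_mul]
  refine ⟨((a z₀)⁻¹ • a) ^ n, A.pow_mem (A.smul_mem ha _) n, fun z _ => ?_, fun z hz => ?_,
    z₀, ⟨hz₀, hz₀V⟩, by simp [hne0]⟩
  · rw [hval]
    exact pow_le_one₀ (by positivity) ((div_le_one hpos).2 (a.norm_coe_le_norm z))
  · rw [hval]
    refine le_trans (pow_le_pow_left₀ (by positivity) ?_ n) hn.le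
    exact div_le_div_of_nonneg_right (hmax hz) hpos.le

/-- Sums of `m` peaking functions over nested open sets take values close to `[0, m]`. -/
lemma exists_near_segment (hK : Minimal (IsClosedBoundary A) K) (m : ℕ) :
    ∀ {V : Set Z}, IsOpen V → (K ∩ V).Nonempty → ∀ {ε : ℝ}, 0 < ε →
      ∃ g ∈ A, (∀ z ∈ K, ∃ r : ℝ, 0 ≤ r ∧ r ≤ m ∧ ‖g z - r‖ ≤ 1 + ε) ∧
        (∀ z ∈ K \ V, ‖g z‖ ≤ ε) ∧ ∃ z ∈ K ∩ V, ‖g z - m‖ ≤ ε := by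
  induction m with
  | zero =>
    intro V _ hKV ε hε
    refine ⟨0, A.zero_mem, fun z _ => ⟨0, le_rfl, by simp, by simp; linarith⟩,
      fun z _ => by simpa using hε.le, hKV.imp fun z hz => ⟨hz, by simpa using hε.le⟩⟩
  | succ m ih =>
    intro V hV hKV ε hε
    obtain ⟨g, hg, hg1, hg2, z₀, hz₀, hz₀'⟩ := ih hV hKV (half_pos hε)
    -- The next peak is placed where `g` is already close to `m`. There `r = m` serves, with the
    -- peak adding at most `1` to the error; elsewhere on `K` the peak is at most `ε / 2` and the
    -- old `r` serves.
    have hW : IsOpen (V ∩ {z | ‖g z - m‖ < ε}) :=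
      hV.inter (isOpen_lt (g.continuous.sub continuous_const).norm continuous_const)
    obtain ⟨a, ha, ha1, ha2, z₁, hz₁, hz₁'⟩ := exists_peak hK hW
      ⟨z₀, hz₀.1, hz₀.2, by simpa using hz₀'.trans_lt (half_lt_self hε)⟩ (half_pos hε)
    refine ⟨g + a, A.add_mem hg ha, fun z hz => ?_, fun z hz => ?_, z₁, ⟨hz₁.1, hz₁.2.1⟩, ?_⟩
    · by_cases hzW : z ∈ V ∩ {z | ‖g z - m‖ < ε}
      · refine ⟨m, by positivity, by push_cast; linarith, ?_⟩
        have h1 : ‖g z - m‖ < ε := hzW.2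
        have h2 := ha1 z hz
        have h3 := norm_add_le (g z - m) (a z)
        calc ‖(g + a) z - ((m : ℝ) : ℂ)‖ = ‖(g z - m) + a z‖ := by
              simp only [ContinuousMap.add_apply, Complex.ofReal_natCast]; ring_nf
          _ ≤ 1 + ε := by linarith
      · obtain ⟨r, hr0, hrm, hr⟩ := hg1 z hz
        refine ⟨r, hr0, by push_cast; linarith, ?_⟩
        have h2 := ha2 z ⟨hz, hzW⟩
        have h3 := norm_add_le (g z - r) (a z)
        calc ‖(g + a) z - (r : ℂ)‖ = ‖(g z - r) + a z‖ := by
              simp only [ContinuousMap.add_apply]; ring_nf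
          _ ≤ 1 + ε := by linarith
    · have h1 := hg2 z hz
      have h2 := ha2 z ⟨hz.1, fun h => hz.2 h.1⟩
      have h3 := norm_add_le (g z) (a z)
      simp only [ContinuousMap.add_apply]
      linarith
    · have h1 : ‖g z₁ - m‖ < ε := hz₁.2.2
      simpa [hz₁', add_sub_add_right_eq_sub] using h1.le

/-- A Urysohn type lemma: functions of `A` with values close to `[0, 1]` on a minimal boundary. -/
lemma exists_urysohn (hK : Minimal (IsClosedBoundary A) K) {V : Set Z} (hV : IsOpen V)
    (hKV : (K ∩ V).Nonempty) {ε : ℝ} (hε : 0 < ε) :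
    ∃ a ∈ A, (∀ z ∈ K, ‖a z‖ + ‖1 - a z‖ ≤ 1 + ε) ∧ (∀ z ∈ K \ V, ‖a z‖ ≤ ε) ∧
      ∃ z ∈ K ∩ V, 1 - ε ≤ ‖a z‖ := by
  -- Before division by `k`, the two norms are at most `r + 2` and `k - r + 2`, with sum `k + 4`;
  -- this choice of `k` makes `4 / k < ε`.
  obtain ⟨k, hk⟩ := exists_nat_gt (4 / ε)
  have hk0 : (0 : ℝ) < k := lt_trans (by positivity) hk
  have hk1 : (1 : ℝ) ≤ k := by exact_mod_cast Nat.one_le_iff_ne_zero.2 (by rintro rfl; simp at hk0)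
  have hkc : (k : ℂ) ≠ 0 := by exact_mod_cast hk0.ne'
  rw [div_lt_iff₀ hε] at hk
  set δ := min ε 1 with hδ
  have hδε : δ ≤ ε := min_le_left _ _
  have hδ1 : δ ≤ 1 := min_le_right _ _
  obtain ⟨g, hg, hg1, hg2, z₀, hz₀, hz₀'⟩ := exists_near_segment hK k hV hKV
    (lt_min hε one_pos : 0 < δ)
  have hval : ∀ z, ((k : ℂ)⁻¹ • g) z = g z / k := fun z => by simp [div_eq_inv_mul]
  have hdk : ε / k ≤ ε := div_le_self hε.le hk1
  refine ⟨(k : ℂ)⁻¹ • g, A.smul_mem hg _, fun z hz => ?_, fun z hz => ?_, z₀, hz₀, ?_⟩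
  · obtain ⟨r, hr0, hrk, hr⟩ := hg1 z hz
    rw [hval]
    have h1 : ‖g z‖ ≤ r + 2 := by
      have := norm_add_le (g z - r) (r : ℂ)
      rw [sub_add_cancel, Complex.norm_real, Real.norm_of_nonneg hr0] at this
      linarith
    have h2 : ‖(k : ℂ) - g z‖ ≤ k - r + 2 := by
      have h := norm_add_le ((k - r : ℝ) : ℂ) ((r : ℂ) - g z)
      rw [Complex.norm_real, Real.norm_of_nonneg (sub_nonneg.2 hrk), norm_sub_rev (r : ℂ)] at h
      have h' : ((k - r : ℝ) : ℂ) + ((r : ℂ) - g z) = k - g z := by push_cast; ring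
      rw [h'] at h
      linarith
    have h3 : 1 - g z / k = (k - g z) / k := by field_simp
    rw [h3, norm_div, norm_div, Complex.norm_natCast, ← add_div, div_le_iff₀ hk0]
    nlinarith
  · rw [hval, norm_div, Complex.norm_natCast, div_le_iff₀ hk0]
    nlinarith [hg2 z hz]
  · rw [hval, norm_div, Complex.norm_natCast, le_div_iff₀ hk0]
    have h := norm_add_le (g z₀) (k - g z₀)
    rw [add_sub_cancel, Complex.norm_natCast, norm_sub_rev] at h
    nlinarith

/-- Restriction to a boundary is injective on `A`. -/
lemma finiteDimensional_of_finite_boundary (hK : IsClosedBoundary A K) (hfin : K.Finite) :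
    FiniteDimensional ℂ A := by
  have : Finite K := hfin
  let T : A →ₗ[ℂ] (K → ℂ) :=
    { toFun := fun a z => (a : C(Z, ℂ)) z
      map_add' := fun _ _ => rfl
      map_smul' := fun _ _ => rfl }
  refine Module.Finite.of_injective T ((injective_iff_map_eq_zero T).2 fun a ha => ?_)
  obtain ⟨z, hz, hz'⟩ := hK.2 a a.2
  have h0 : (a : C(Z, ℂ)) z = 0 := congrFun ha ⟨z, hz⟩
  rw [h0, norm_zero] at hz'
  exact Subtype.ext (norm_eq_zero.1 hz'.symm)

end Boundary

/-! ### Disjoint open sets and weak convergence -/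

lemma exists_disjoint_open_of_infinite {Z : Type*} [TopologicalSpace Z] [T2Space Z]
    {K : Set Z} (hK : K.Infinite) :
    ∃ V : ℕ → Set Z, (∀ n, IsOpen (V n)) ∧ (∀ n, (K ∩ V n).Nonempty) ∧
      ∀ m n, ∀ z ∈ K, z ∈ V m → z ∈ V n → m = n := by
  have : Infinite K := hK.to_subtype
  obtain ⟨U, hU, hUo, hd⟩ := exists_seq_infinite_isOpen_pairwise_disjoint K
  choose V hV hVU using fun n => isOpen_induced_iff.1 (hUo n)
  refine ⟨V, hV, fun n => ?_, fun m n z hz hm hn => ?_⟩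
  · obtain ⟨z, hz⟩ := (hU n).nonempty
    rw [← hVU n] at hz
    exact ⟨z, z.2, hz⟩
  · refine hd.eq (Set.not_disjoint_iff.2 ⟨⟨z, hz⟩, ?_, ?_⟩)
    · rw [← hVU m]; exact hm
    · rw [← hVU n]; exact hn

/-- Convergence in the weak topology is convergence under all continuous functionals. -/
lemma tendsto_toWeakSpace {E ι : Type*} [NormedAddCommGroup E] [NormedSpace ℂ E] {l : Filter ι}
    {e : ι → E} {e₀ : E} 
    (h : ∀ L : StrongDual ℂ E, Filter.Tendsto (fun i => L (e i)) l (nhds (L e₀))) :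
    Filter.Tendsto (fun i => toWeakSpace ℂ E (e i)) l (nhds (toWeakSpace ℂ E e₀)) := by
  have hind : Topology.IsInducing
      (fun x : WeakBilin (topDualPairing ℂ E).flip => fun y => (topDualPairing ℂ E).flip x y) := ⟨rfl⟩
  exact hind.tendsto_nhds_iff.2 (tendsto_pi_nhds.2 h)

/-- A sequence whose finite unimodular sums are bounded is weakly null. -/
lemma tendsto_zero_of_sum_bounded {E : Type*} [NormedAddCommGroup E] [NormedSpace ℂ E]
    {e : ℕ → E} {C : ℝ}
    (h : ∀ (F : Finset ℕ) (c : ℕ → ℂ), (∀ n, ‖c n‖ ≤ 1) → ‖∑ n ∈ F, c n • e n‖ ≤ C)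
    (L : StrongDual ℂ E) : Filter.Tendsto (fun n => L (e n)) Filter.atTop (nhds 0) := by
  refine tendsto_zero_iff_norm_tendsto_zero.2 (Summable.tendsto_atTop_zero
    (summable_of_sum_le (c := ‖L‖ * C) (fun n => norm_nonneg _) fun F => ?_))
  -- Rotating each `L (e n)` onto the positive axis bounds the partial sums of `‖L (e n)‖`.
  have hc : ∀ z : ℂ, ∃ c : ℂ, ‖c‖ ≤ 1 ∧ c * z = ‖z‖ := fun z => by
    rcases eq_or_ne z 0 with rfl | hz
    · exact ⟨0, by simp, by simp⟩
    · have : (‖z‖ : ℝ) ≠ 0 := norm_ne_zero_iff.2 hz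
      exact ⟨‖z‖ / z, by simp [this], div_mul_cancel₀ _ hz⟩
  choose c hc1 hc2 using hc
  have h1 : L (∑ n ∈ F, c (L (e n)) • e n) = ((∑ n ∈ F, ‖L (e n)‖ : ℝ) : ℂ) := by
    simp [map_sum, hc2]
  calc ∑ n ∈ F, ‖L (e n)‖ = ‖((∑ n ∈ F, ‖L (e n)‖ : ℝ) : ℂ)‖ := by
        rw [Complex.norm_real, Real.norm_of_nonneg (Finset.sum_nonneg fun _ _ => norm_nonneg _)]
    _ ≤ ‖L‖ * ‖∑ n ∈ F, c (L (e n)) • e n‖ := h1 ▸ L.le_opNorm _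
    _ ≤ ‖L‖ * C := by gcongr; exact h F _ fun n => hc1 _

/-! ### The diameter two property for modules of vector-valued functions -/

section Module

open WeakDual

variable {Ω : Type*} [TopologicalSpace Ω] {X : Type*} [NormedAddCommGroup X] [NormedSpace ℂ X]

/-- Evaluation of `x ∘ f` at a character of `C_b(Ω)`. -/
noncomputable def characterEval (z : characterSpace ℂ (Ω →ᵇ ℂ)) (x : StrongDual ℂ X) :
    (Ω →ᵇ X) →ₗ[ℂ] ℂ :=
  (CharacterSpace.toAlgHom z).toLinearMap ∘ₗ (x.compLeftContinuousBounded Ω).toLinearMap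

lemma characterEval_apply (z : characterSpace ℂ (Ω →ᵇ ℂ)) (x : StrongDual ℂ X) (f : Ω →ᵇ X) :
    characterEval z x f = z (x.compLeftContinuousBounded Ω f) := rfl

lemma characterEval_smul (z : characterSpace ℂ (Ω →ᵇ ℂ)) (x : StrongDual ℂ X) (φ : Ω →ᵇ ℂ)
    (f : Ω →ᵇ X) : characterEval z x (φ • f) = z φ * characterEval z x f := by
  have h : x.compLeftContinuousBounded Ω (φ • f) = φ * x.compLeftContinuousBounded Ω f := by
    ext t
    exact (x.map_smul (φ t) (f t)).trans rfl
  rw [characterEval_apply, h, map_mul, characterEval_apply]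

lemma norm_character_apply_le (z : characterSpace ℂ (Ω →ᵇ ℂ)) (φ : Ω →ᵇ ℂ) : ‖z φ‖ ≤ ‖φ‖ := by
  rw [← (AddMonoidHomClass.isometry_iff_norm _).1 (gelfandTransform_isometry (Ω →ᵇ ℂ)) φ]
  exact (gelfandTransform ℂ (Ω →ᵇ ℂ) φ).norm_coe_le_norm z

lemma norm_characterEval_le (z : characterSpace ℂ (Ω →ᵇ ℂ)) {x : StrongDual ℂ X} (hx : ‖x‖ ≤ 1)
    (f : Ω →ᵇ X) : ‖characterEval z x f‖ ≤ ‖f‖ := by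
  refine (norm_character_apply_le z _).trans
    ((BoundedContinuousFunction.norm_le (norm_nonneg _)).2 fun t => ?_)
  calc ‖x (f t)‖ ≤ ‖x‖ * ‖f t‖ := x.le_opNorm _
    _ ≤ 1 * ‖f‖ := by gcongr; exact f.norm_coe_le_norm t
    _ = ‖f‖ := one_mul _

lemma continuous_characterEval (x : StrongDual ℂ X) (f : Ω →ᵇ X) :
    Continuous fun z : characterSpace ℂ (Ω →ᵇ ℂ) => characterEval z x f :=
  (gelfandTransform ℂ (Ω →ᵇ ℂ) (x.compLeftContinuousBounded Ω f)).continuous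

variable {A : Subalgebra ℂ (Ω →ᵇ ℂ)} {K : Set (characterSpace ℂ (Ω →ᵇ ℂ))}

/-- Hahn–Banach reduces `‖f t‖` to a scalar function in `A`, which attains its norm on `K`. Norm
estimates thus only need checking on `K`. -/
lemma norm_le_of_characterEval_le
    (hK : IsClosedBoundary (A.map (gelfandTransform ℂ (Ω →ᵇ ℂ))) K) {f : Ω →ᵇ X}
    (hf : ∀ x : StrongDual ℂ X, x.compLeftContinuousBounded Ω f ∈ A) {C : ℝ} (hC : 0 ≤ C)
    (h : ∀ z ∈ K, ∀ x : StrongDual ℂ X, ‖x‖ ≤ 1 → ‖characterEval z x f‖ ≤ C) : ‖f‖ ≤ C := by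
  refine (BoundedContinuousFunction.norm_le hC).2 fun t => ?_
  obtain ⟨x, hx, hxt⟩ := exists_dual_vector'' ℂ (f t)
  obtain ⟨z, hz, hz'⟩ := hK.2 _ (Subalgebra.mem_map.2 ⟨_, hf x, rfl⟩)
  have hiso := (AddMonoidHomClass.isometry_iff_norm _).1 (gelfandTransform_isometry (Ω →ᵇ ℂ))
    (x.compLeftContinuousBounded Ω f)
  calc ‖f t‖ = ‖x.compLeftContinuousBounded Ω f t‖ := by simp [hxt]
    _ ≤ ‖x.compLeftContinuousBounded Ω f‖ := BoundedContinuousFunction.norm_coe_le_norm _ t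
    _ = ‖characterEval z x f‖ := by rw [← hiso, ← hz']; rfl
    _ ≤ C := h z hz x hx

variable {E : Type*} [NormedAddCommGroup E] [NormedSpace ℂ E] {J : E →ₗᵢ[ℂ] (Ω →ᵇ X)}

/-- A vector `e` with a functional sending it to the constant `1` is bounded away from zero over `K
∩ V`. Rescaling by its supremum there gives `h`, and `φ` is concentrated where `h` is nearly of norm
`1`. -/
lemma exists_multiplier_and_vector
    (hK : Minimal (IsClosedBoundary (A.map (gelfandTransform ℂ (Ω →ᵇ ℂ)))) K)
    (hone : ∃ (e : E) (x : StrongDual ℂ X), x.compLeftContinuousBounded Ω (J e) = 1)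
    {V : Set (characterSpace ℂ (Ω →ᵇ ℂ))} (hV : IsOpen V) (hKV : (K ∩ V).Nonempty)
    {δ : ℝ} (hδ : 0 < δ) (hδ1 : δ ≤ 1) :
    ∃ φ ∈ A, ∃ h : E, (∀ z ∈ K, ‖z φ‖ + ‖1 - z φ‖ ≤ 1 + δ) ∧ (∀ z ∈ K \ V, ‖z φ‖ ≤ δ) ∧
      (∀ z ∈ K, ∀ x : StrongDual ℂ X, ‖x‖ ≤ 1 → ‖z φ * characterEval z x (J h)‖ ≤ ‖z φ‖ + δ) ∧
      (∀ z ∈ K \ V, ∀ x : StrongDual ℂ X, ‖x‖ ≤ 1 → ‖z φ * characterEval z x (J h)‖ ≤ δ) ∧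
      ∃ z ∈ K, ∃ x : StrongDual ℂ X, ‖x‖ ≤ 1 ∧ 1 - δ ≤ ‖z φ * characterEval z x (J h)‖ := by
  obtain ⟨e, x₁, hx₁⟩ := hone
  obtain ⟨z₀, hz₀⟩ := hKV
  set R : Set ℝ := {r | ∃ z ∈ K ∩ V, ∃ x : StrongDual ℂ X, ‖x‖ ≤ 1 ∧ r = ‖characterEval z x (J e)‖}
    with hR
  have hRb : BddAbove R := ⟨‖J e‖, by
    rintro r ⟨z, -, x, hx, rfl⟩
    exact norm_characterEval_le z hx _⟩
  have hev : characterEval z₀ x₁ (J e) = 1 := by rw [characterEval_apply, hx₁, map_one]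
  have hx₁0 : 0 < ‖x₁‖ := norm_pos_iff.2 fun h => by
    have h0 : x₁.compLeftContinuousBounded Ω (J e) = 0 := by ext t; simp [h]
    rw [characterEval_apply, h0, map_zero] at hev
    exact zero_ne_one hev
  have hmem : ‖x₁‖⁻¹ ∈ R := by
    refine ⟨z₀, hz₀, (‖x₁‖⁻¹ : ℂ) • x₁, ?_, ?_⟩
    · rw [norm_smul]; simp [hx₁0.ne']
    · have : characterEval z₀ ((‖x₁‖⁻¹ : ℂ) • x₁) (J e)
          = (‖x₁‖⁻¹ : ℂ) * characterEval z₀ x₁ (J e) := by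
        have h : ((‖x₁‖⁻¹ : ℂ) • x₁).compLeftContinuousBounded Ω (J e)
            = (‖x₁‖⁻¹ : ℂ) • x₁.compLeftContinuousBounded Ω (J e) := by ext t; simp
        rw [characterEval_apply, h, map_smul, smul_eq_mul, characterEval_apply]
      rw [this, hev]; simp
  set s := sSup R with hs
  have hs0 : 0 < s := (inv_pos.2 hx₁0).trans_le (le_csSup hRb hmem)
  obtain ⟨r, ⟨z₂, hz₂, x₂, hx₂, rfl⟩, hr⟩ := exists_lt_of_lt_csSup ⟨_, hmem⟩
    (show (1 - δ / 2) * s < sSup R by rw [← hs]; nlinarith)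
  set W := V ∩ {z | (1 - δ / 2) * s < ‖characterEval z x₂ (J e)‖} with hW
  have hWo : IsOpen W :=
    hV.inter (isOpen_lt continuous_const (continuous_characterEval x₂ (J e)).norm)
  set h : E := (s⁻¹ : ℂ) • e with hh
  have hevh : ∀ z x, ‖characterEval z x (J h)‖ = ‖characterEval z x (J e)‖ / s := fun z x => by
    rw [hh, map_smul, map_smul, norm_smul, norm_inv, Complex.norm_real, Real.norm_of_nonneg hs0.le,
      div_eq_inv_mul]
  -- The vector `h` may be large away from `K ∩ V`; the second term makes `φ` small enough to absorb
  -- `‖h‖`. The first gives `(1 - δ / 2) ^ 2 ≥ 1 - δ` at the peak.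
  set δ' := min (δ / 2) (δ / (1 + ‖h‖)) with hδ'
  have hp : 0 < 1 + ‖h‖ := by positivity
  have hδ'0 : 0 < δ' := lt_min (half_pos hδ) (by positivity)
  have hδ'1 : δ' ≤ δ / 2 := min_le_left _ _
  have hδ'2 : δ' * ‖h‖ ≤ δ := by
    have : δ' * (1 + ‖h‖) ≤ δ := (le_div_iff₀ hp).1 (min_le_right _ _)
    nlinarith
  obtain ⟨a, ha, ha1, ha2, z₃, hz₃, hz₃'⟩ := exists_urysohn hK hWo ⟨z₂, hz₂.1, hz₂.2, hr⟩ hδ'0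
  obtain ⟨φ, hφ, rfl⟩ := Subalgebra.mem_map.1 ha
  simp only [gelfandTransform_apply_apply] at ha1 ha2 hz₃'
  have hoff : ∀ z ∈ K \ W, ∀ x : StrongDual ℂ X, ‖x‖ ≤ 1 →
      ‖z φ * characterEval z x (J h)‖ ≤ δ := fun z hz x hx => by
    rw [norm_mul]
    calc ‖z φ‖ * ‖characterEval z x (J h)‖ ≤ δ' * ‖h‖ := by
          gcongr
          · exact ha2 z hz
          · exact (norm_characterEval_le z hx _).trans_eq (J.norm_map h)
      _ ≤ δ := hδ'2
  refine ⟨φ, hφ, h, fun z hz => (ha1 z hz).trans (by linarith),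
    fun z hz => (ha2 z ⟨hz.1, fun h => hz.2 h.1⟩).trans (by linarith), fun z hz x hx => ?_,
    fun z hz => hoff z ⟨hz.1, fun h => hz.2 h.1⟩, z₃, hz₃.1, x₂, hx₂, ?_⟩
  · by_cases hzW : z ∈ W
    · have h1 : ‖characterEval z x (J h)‖ ≤ 1 := by
        rw [hevh, div_le_one hs0]
        exact le_csSup hRb ⟨z, ⟨hz, hzW.1⟩, x, hx, rfl⟩
      rw [norm_mul]
      nlinarith [norm_nonneg (z φ)]
    · linarith [hoff z ⟨hz, hzW⟩ x hx, norm_nonneg (z φ)]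
  · have h1 : 1 - δ / 2 ≤ ‖characterEval z₃ x₂ (J h)‖ := by
      rw [hevh, le_div_iff₀ hs0]
      exact hz₃.2.2.le
    rw [norm_mul]
    nlinarith

/-- Each point of `K` lies in at most one `V n`, which contributes at most `C` to a finite sum with
coefficients of modulus at most `1`; the geometric tails contribute at most `2 * C`. So such sums
are bounded. -/
lemma tendsto_zero_of_disjoint_supports
    (hK : IsClosedBoundary (A.map (gelfandTransform ℂ (Ω →ᵇ ℂ))) K)
    (hbase : ∀ (e : E) (x : StrongDual ℂ X), x.compLeftContinuousBounded Ω (J e) ∈ A)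
    {V : ℕ → Set (characterSpace ℂ (Ω →ᵇ ℂ))}
    (hV : ∀ m n, ∀ z ∈ K, z ∈ V m → z ∈ V n → m = n) {e : ℕ → E} {C : ℝ} (hC : 0 ≤ C)
    (h1 : ∀ n, ∀ z ∈ K, ∀ x : StrongDual ℂ X, ‖x‖ ≤ 1 → ‖characterEval z x (J (e n))‖ ≤ C)
    (h2 : ∀ n, ∀ z ∈ K \ V n, ∀ x : StrongDual ℂ X, ‖x‖ ≤ 1 →
      ‖characterEval z x (J (e n))‖ ≤ C * (1 / 2) ^ n) (L : StrongDual ℂ E) :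
    Filter.Tendsto (fun n => L (e n)) Filter.atTop (nhds 0) := by
  classical
  refine tendsto_zero_of_sum_bounded (C := 3 * C) (fun F c hc => ?_) L
  rw [← J.norm_map]
  refine norm_le_of_characterEval_le hK (hbase _) (by positivity) fun z hz x hx => ?_
  calc ‖characterEval z x (J (∑ n ∈ F, c n • e n))‖
      = ‖∑ n ∈ F, c n * characterEval z x (J (e n))‖ := by simp [map_sum]
    _ ≤ ∑ n ∈ F, ((if z ∈ V n then C else 0) + C * (1 / 2) ^ n) := by
        refine norm_sum_le_of_le _ fun n _ => ?_
        have h3 : ‖c n * characterEval z x (J (e n))‖ ≤ ‖characterEval z x (J (e n))‖ := by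
          rw [norm_mul]
          exact mul_le_of_le_one_left (norm_nonneg _) (hc n)
        refine h3.trans ?_
        split_ifs with hzn
        · exact (h1 n z hz x hx).trans (le_add_of_nonneg_right (by positivity))
        · simpa using h2 n z ⟨hz, hzn⟩ x hx
    _ ≤ C + C * 2 := by
        rw [Finset.sum_add_distrib, ← Finset.mul_sum]
        gcongr
        · rw [← Finset.sum_filter, Finset.sum_const, nsmul_eq_mul]
          refine mul_le_of_le_one_left hC ?_
          exact_mod_cast Finset.card_le_one.2 fun m hm n hn =>
            hV m n z hz (Finset.mem_filter.1 hm).2 (Finset.mem_filter.1 hn).2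
        · exact (summable_geometric_two.sum_le_tsum F fun _ _ => by positivity).trans_eq
            tsum_geometric_two
    _ = 3 * C := by ring

/-- A space of vector-valued functions which is a module over an infinite-dimensional algebra of
bounded continuous functions containing its base functions has the diameter two property. -/
theorem hasD2P_of_module (J : E →ₗᵢ[ℂ] (Ω →ᵇ X)) (A : Subalgebra ℂ (Ω →ᵇ ℂ))
    (hbase : ∀ (e : E) (x : StrongDual ℂ X), x.compLeftContinuousBounded Ω (J e) ∈ A)
    (hsmul : ∀ φ ∈ A, ∀ e : E, ∃ e' : E, J e' = φ • J e)
    (hone : ∃ (e : E) (x : StrongDual ℂ X), x.compLeftContinuousBounded Ω (J e) = 1)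
    (hinf : ¬ FiniteDimensional ℂ A) : HasD2P E := by
  -- Nonemptiness of `Ω` makes `C_b(Ω)` nontrivial, so that it has characters.
  have hΩ : Nonempty Ω := by
    by_contra hΩ
    rw [not_nonempty_iff] at hΩ
    have : Subsingleton (Ω →ᵇ ℂ) := ⟨fun f g => by ext t; exact hΩ.elim t⟩
    exact hinf inferInstance
  have hnt : Nontrivial (Ω →ᵇ ℂ) :=
    ⟨0, 1, fun h => zero_ne_one (DFunLike.congr_fun h hΩ.some)⟩
  obtain ⟨K, hK⟩ := exists_minimal_isClosedBoundary (A.map (gelfandTransform ℂ (Ω →ᵇ ℂ)))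
  have hKinf : K.Infinite := fun hfin => by
    have := finiteDimensional_of_finite_boundary hK.prop hfin
    exact hinf (Module.Finite.equiv (Subalgebra.equivMapOfInjective A _
      (gelfandTransform_isometry (Ω →ᵇ ℂ)).injective).symm.toLinearEquiv)
  obtain ⟨V, hVo, hVne, hVd⟩ := exists_disjoint_open_of_infinite hKinf
  intro U hU hne
  have hsub : toWeakSpace ℂ E ⁻¹' U ∩ Metric.closedBall (0 : E) 1 ⊆ Metric.closedBall 0 1 :=
    Set.inter_subset_right
  refine le_antisymm ((Metric.diam_mono hsub Metric.isBounded_closedBall).trans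
    ((Metric.diam_closedBall zero_le_one).trans_eq (mul_one 2))) ?_
  obtain ⟨f, hfU, hf⟩ := hne
  rw [mem_closedBall_zero_iff] at hf
  refine le_of_forall_lt fun d hd => ?_
  -- The perturbed vectors will have norm at most `1 + 2 * ε`: one `ε` from `|φ| + |1 - φ|`, one
  -- from the bound on `φ • h`. Dividing by this factor must keep `f` in `U` and the final distance
  -- above `d`.
  obtain ⟨ε, ⟨hεU, hεd⟩, hε0, hε1⟩ : ∃ ε : ℝ,
      (((1 + 2 * ε : ℝ) : ℂ)⁻¹ • f ∈ toWeakSpace ℂ E ⁻¹' U ∧ d < 2 * (1 + 2 * ε)⁻¹ * (1 - ε)) ∧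
        0 < ε ∧ ε ≤ 1 := by
    have hUo : IsOpen (toWeakSpace ℂ E ⁻¹' U) := hU.preimage (toWeakSpaceCLM ℂ E).continuous
    have c1 : ContinuousAt (fun ε : ℝ => ((1 + 2 * ε : ℝ) : ℂ)⁻¹ • f) 0 := by
      refine ContinuousAt.smul (ContinuousAt.inv₀ (by fun_prop) (by simp)) continuousAt_const
    have c2 : ContinuousAt (fun ε : ℝ => 2 * (1 + 2 * ε)⁻¹ * (1 - ε)) 0 :=
      (continuousAt_const.mul (ContinuousAt.inv₀ (by fun_prop) (by simp))).mul (by fun_prop)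
    have e1 := c1.eventually_mem (hUo.mem_nhds (by simpa using hfU))
    have e2 := c2.eventually_const_lt (u := d) (by simpa using hd)
    have e3 : ∀ᶠ ε : ℝ in nhdsWithin 0 (Set.Ioi 0), 0 < ε ∧ ε ≤ 1 :=
      Ioc_mem_nhdsGT one_pos
    exact (((e1.and e2).filter_mono nhdsWithin_le_nhds).and e3).exists
  have hδ : ∀ n : ℕ, 0 < ε * (1 / 2) ^ n := fun n => by positivity
  have hδε : ∀ n : ℕ, ε * (1 / 2) ^ n ≤ ε := fun n =>
    mul_le_of_le_one_right hε0.le (pow_le_one₀ (by norm_num) (by norm_num))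
  have hδ1 : ∀ n : ℕ, ε * (1 / 2) ^ n ≤ 1 * (1 / 2) ^ n := fun n => by gcongr
  choose φ hφ h hA hB hC hD z hz x hx hE using fun n =>
    exists_multiplier_and_vector hK hone (hVo n) (hVne n) (hδ n) ((hδε n).trans hε1)
  choose p hp using fun n => hsmul (φ n) (hφ n) f
  choose q hq using fun n => hsmul (φ n) (hφ n) (h n)
  have hpe : ∀ n z (x : StrongDual ℂ X),
      characterEval z x (J (p n)) = z (φ n) * characterEval z x (J f) :=
    fun n z x => by rw [hp, characterEval_smul]
  have hqe : ∀ n z (x : StrongDual ℂ X),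
      characterEval z x (J (q n)) = z (φ n) * characterEval z x (J (h n)) :=
    fun n z x => by rw [hq, characterEval_smul]
  have hfe : ∀ z (x : StrongDual ℂ X), ‖x‖ ≤ 1 → ‖characterEval z x (J f)‖ ≤ 1 :=
    fun z x hx => (norm_characterEval_le z hx _).trans ((J.norm_map f).trans_le hf)
  have hφ2 : ∀ n, ∀ z ∈ K, ‖z (φ n)‖ ≤ 2 := fun n z hz => by
    linarith [hA n z hz, hδε n, norm_nonneg (1 - z (φ n))]
  have hpn : ∀ n z (x : StrongDual ℂ X), ‖x‖ ≤ 1 → ‖characterEval z x (J (p n))‖ ≤ ‖z (φ n)‖ :=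
    fun n z x hx => by
      rw [hpe, norm_mul]
      exact mul_le_of_le_one_right (norm_nonneg _) (hfe z x hx)
  have hpw : ∀ L : StrongDual ℂ E, Filter.Tendsto (fun n => L (p n)) Filter.atTop (nhds 0) :=
    tendsto_zero_of_disjoint_supports hK.prop hbase hVd (C := 3) (by norm_num)
      (fun n z hz x hx => by linarith [hpn n z x hx, hφ2 n z hz])
      (fun n z hz x hx => by
        have : (0 : ℝ) < (1 / 2) ^ n := by positivity
        linarith [hpn n z x hx, hB n z hz, hδ1 n])
  have hqw : ∀ L : StrongDual ℂ E, Filter.Tendsto (fun n => L (q n)) Filter.atTop (nhds 0) :=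
    tendsto_zero_of_disjoint_supports hK.prop hbase hVd (C := 3) (by norm_num)
      (fun n z hz x hx => by
        rw [hqe]; linarith [hC n z hz x hx, hφ2 n z hz, hδε n])
      (fun n z hz x hx => by
        have : (0 : ℝ) < (1 / 2) ^ n := by positivity
        rw [hqe]; linarith [hD n z hz x hx, hδ1 n])
  set c : ℝ := (1 + 2 * ε)⁻¹ with hc
  have hc0 : 0 < c := by positivity
  have hcc : ((1 + 2 * ε : ℝ) : ℂ)⁻¹ = (c : ℂ) := by rw [hc]; push_cast; rfl
  rw [hcc] at hεU
  -- Used for `σ = 1` and `σ = -1`, whose vectors differ by `2 * c` times `q n`.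
  have hmem : ∀ σ : ℂ, ‖σ‖ = 1 → ∀ᶠ n in Filter.atTop, (c : ℂ) • (f - p n + σ • q n) ∈
      toWeakSpace ℂ E ⁻¹' U ∩ Metric.closedBall (0 : E) 1 := fun σ hσ => by
    have ht : Filter.Tendsto (fun n => toWeakSpace ℂ E ((c : ℂ) • (f - p n + σ • q n)))
        Filter.atTop (nhds (toWeakSpace ℂ E ((c : ℂ) • f))) := by
      refine tendsto_toWeakSpace fun L => ?_
      have := (((hpw L).const_sub (L f)).add ((hqw L).const_mul σ)).const_mul (c : ℂ)
      simpa [mul_add] using this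
    filter_upwards [ht.eventually_mem (hU.mem_nhds hεU)] with n hn
    refine ⟨hn, ?_⟩
    rw [mem_closedBall_zero_iff, norm_smul, Complex.norm_real, Real.norm_of_nonneg hc0.le, hc,
      inv_mul_le_iff₀ (by positivity), mul_one, ← J.norm_map]
    refine norm_le_of_characterEval_le hK.prop (hbase _) (by positivity) fun z hz x hx => ?_
    have h1 : characterEval z x (J (f - p n + σ • q n)) =
        (1 - z (φ n)) * characterEval z x (J f)
          + σ * (z (φ n) * characterEval z x (J (h n))) := by
      simp only [map_add, map_sub, map_smul, hpe, hqe, smul_eq_mul]; ring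
    have h2 : ‖(1 - z (φ n)) * characterEval z x (J f)‖ ≤ ‖1 - z (φ n)‖ := by
      rw [norm_mul]
      exact mul_le_of_le_one_right (norm_nonneg _) (hfe z x hx)
    rw [h1]
    refine (norm_add_le _ _).trans ?_
    rw [norm_mul σ, hσ, one_mul]
    linarith [hA n z hz, hC n z hz x hx, hδε n]
  obtain ⟨n, hn1, hn2⟩ := ((hmem 1 (by simp)).and (hmem (-1) (by simp))).exists
  refine lt_of_lt_of_le ?_ (Metric.dist_le_diam_of_mem
    (Metric.isBounded_closedBall.subset hsub) hn1 hn2)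
  have hdiff : (c : ℂ) • (f - p n + (1 : ℂ) • q n) - (c : ℂ) • (f - p n + (-1 : ℂ) • q n)
      = ((2 * c : ℝ) : ℂ) • q n := by
    push_cast
    module
  have hqn : 1 - ε ≤ ‖q n‖ := by
    have := hE n
    rw [← hqe] at this
    have h3 := (norm_characterEval_le (z n) (hx n) (J (q n))).trans_eq (J.norm_map _)
    linarith [hδε n]
  rw [dist_eq_norm, hdiff, norm_smul, Complex.norm_real, Real.norm_of_nonneg (by positivity)]
  refine hεd.trans_le ?_
  gcongr

end Module

/-! ### Infinite dimensionality and function spaces on the unit ball -/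

/-- In a finite-dimensional algebra `g` would satisfy a monic polynomial, and every value of `g`
would be a root of it. -/
lemma not_finiteDimensional_of_infinite_range {Ω : Type*} [TopologicalSpace Ω]
    {A : Subalgebra ℂ (Ω →ᵇ ℂ)} {g : Ω →ᵇ ℂ} (hg : g ∈ A) (hr : (Set.range g).Infinite) :
    ¬ FiniteDimensional ℂ A := fun hfin => by
  obtain ⟨p, hp, hp0⟩ := Algebra.IsIntegral.isIntegral (R := ℂ) (⟨g, hg⟩ : A)
  refine hp.ne_zero (Polynomial.eq_zero_of_infinite_isRoot p (hr.mono ?_))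
  rintro _ ⟨t, rfl⟩
  let T : A →ₐ[ℂ] ℂ := ((ContinuousMap.evalAlgHom ℂ ℂ t).comp
    (BoundedContinuousFunction.toContinuousMapₐ ℂ)).comp A.val
  have h : T (Polynomial.aeval ⟨g, hg⟩ p) = 0 := by
    rw [Polynomial.aeval_def, hp0, map_zero]
  rw [← Polynomial.aeval_algHom_apply] at h
  simpa [T, Polynomial.IsRoot] using h

lemma UniformContinuous.boundedContinuousFunction_smul {Z Y : Type*} [UniformSpace Z]
    [NormedAddCommGroup Y] [NormedSpace ℂ Y] {φ : Z →ᵇ ℂ} {f : Z →ᵇ Y} (hφ : UniformContinuous φ)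
    (hf : UniformContinuous f) : UniformContinuous (φ • f : Z →ᵇ Y) := by
  have h1 := tendsto_uniformity_iff_dist_tendsto_zero.1 hφ
  have h2 := tendsto_uniformity_iff_dist_tendsto_zero.1 hf
  refine tendsto_uniformity_iff_dist_tendsto_zero.2 (squeeze_zero (fun _ => dist_nonneg)
    (fun p => ?_) (by simpa using (h1.mul_const ‖f‖).add (h2.const_mul ‖φ‖)))
  have h3 : (φ • f) p.1 - (φ • f) p.2 = (φ p.1 - φ p.2) • f p.1 + φ p.2 • (f p.1 - f p.2) := by
    change φ p.1 • f p.1 - φ p.2 • f p.2 = _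
    module
  rw [dist_eq_norm, dist_eq_norm, dist_eq_norm, h3]
  refine (norm_add_le _ _).trans ?_
  rw [norm_smul, norm_smul]
  gcongr
  · exact f.norm_coe_le_norm _
  · exact φ.norm_coe_le_norm _

section Ball

variable {X Y : Type*} [NormedAddCommGroup X] [NormedSpace ℂ X] [NormedAddCommGroup Y]
  [NormedSpace ℂ Y]

lemma HolBdd.smul_mem {φ : UnitBall X →ᵇ ℂ} (hφ : φ ∈ HolBdd X ℂ) {f : UnitBall X →ᵇ Y}
    (hf : f ∈ HolBdd X Y) : φ • f ∈ HolBdd X Y := by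
  obtain ⟨F, hF, hFe⟩ := hφ
  obtain ⟨G, hG, hGe⟩ := hf
  refine ⟨fun x => F x • G x, hF.smul hG, fun x hx => ?_⟩
  change φ x • f x = F x • G x
  rw [hFe x hx, hGe x hx]

lemma HolBdd.comp_mem {f : UnitBall X →ᵇ Y} (hf : f ∈ HolBdd X Y) (y : StrongDual ℂ Y) :
    y.compLeftContinuousBounded (UnitBall X) f ∈ HolBdd X ℂ := by
  obtain ⟨F, hF, hFe⟩ := hf
  refine ⟨fun x => y (F x), y.differentiable.comp_differentiableOn hF, fun x hx => ?_⟩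
  change y (f x) = y (F x)
  rw [hFe x hx]

lemma HolUnif.const_mem (y : Y) :
    BoundedContinuousFunction.const (UnitBall X) y ∈ HolUnif X Y :=
  ⟨⟨fun _ => y, differentiableOn_const y, fun _ _ => rfl⟩, uniformContinuous_const⟩

lemma HolUnif.smul_mem {φ : UnitBall X →ᵇ ℂ} (hφ : φ ∈ HolUnif X ℂ) {f : UnitBall X →ᵇ Y}
    (hf : f ∈ HolUnif X Y) : φ • f ∈ HolUnif X Y :=
  ⟨HolBdd.smul_mem hφ.1 hf.1, hφ.2.boundedContinuousFunction_smul hf.2⟩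

lemma HolUnif.comp_mem {f : UnitBall X →ᵇ Y} (hf : f ∈ HolUnif X Y) (y : StrongDual ℂ Y) :
    y.compLeftContinuousBounded (UnitBall X) f ∈ HolUnif X ℂ :=
  ⟨HolBdd.comp_mem hf.1 y, y.uniformContinuous.comp hf.2⟩

variable (X) in
/-- `A_b(B_X)` as a subalgebra of `C_b(B_X)`. -/
noncomputable def holBddSubalgebra : Subalgebra ℂ (UnitBall X →ᵇ ℂ) :=
  (HolBdd X ℂ).toSubalgebra (HolUnif.const_mem 1).1 fun _ _ hf hg => HolBdd.smul_mem hf hg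

variable (X) in
/-- `A_u(B_X)` as a subalgebra of `C_b(B_X)`. -/
noncomputable def holUnifSubalgebra : Subalgebra ℂ (UnitBall X →ᵇ ℂ) :=
  (HolUnif X ℂ).toSubalgebra (HolUnif.const_mem 1) fun _ _ hf hg => HolUnif.smul_mem hf hg

/-- The restriction of a continuous linear functional to the unit ball. -/
noncomputable def functionalOnBall (l : StrongDual ℂ X) : UnitBall X →ᵇ ℂ :=
  BoundedContinuousFunction.ofNormedAddCommGroup (fun x => l x)
    (l.continuous.comp continuous_subtype_val) ‖l‖ fun x =>
      (l.le_opNorm x).trans (mul_le_of_le_one_right (norm_nonneg l) (mem_closedBall_zero_iff.1 x.2))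

lemma functionalOnBall_mem (l : StrongDual ℂ X) : functionalOnBall l ∈ HolUnif X ℂ :=
  ⟨⟨l, l.differentiable.differentiableOn, fun _ _ => rfl⟩,
    l.uniformContinuous.comp uniformContinuous_subtype_val⟩

/-- A functional norming a nonzero vector takes every value in `[0, 1]` along the segment from the
origin in that direction. -/
lemma exists_infinite_range [Nontrivial X] : ∃ g ∈ HolUnif X ℂ, (Set.range g).Infinite := by
  obtain ⟨x, hx⟩ := exists_ne (0 : X)
  obtain ⟨l, -, hl⟩ := exists_dual_vector'' ℂ x
  have hx0 : 0 < ‖x‖ := norm_pos_iff.2 hx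
  refine ⟨functionalOnBall l, functionalOnBall_mem l, ?_⟩
  refine Set.Infinite.mono ?_ ((Set.Icc_infinite (zero_lt_one (α := ℝ))).image
    Complex.ofReal_injective.injOn)
  rintro _ ⟨r, ⟨hr0, hr1⟩, rfl⟩
  refine ⟨⟨((r / ‖x‖ : ℝ) : ℂ) • x, ?_⟩, ?_⟩
  · rw [mem_closedBall_zero_iff, norm_smul, Complex.norm_real, Real.norm_of_nonneg (by positivity),
      div_mul_cancel₀ _ hx0.ne']
    exact hr1
  · change l (((r / ‖x‖ : ℝ) : ℂ) • x) = r
    have hl' : l x = ((‖x‖ : ℝ) : ℂ) := hl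
    rw [map_smul, hl', smul_eq_mul, ← Complex.ofReal_mul, div_mul_cancel₀ _ hx0.ne']

lemma exists_comp_const_eq_one (Ω : Type*) [TopologicalSpace Ω] (Y : Type*) [NormedAddCommGroup Y]
    [NormedSpace ℂ Y] [Nontrivial Y] : ∃ (v : Y) (y : StrongDual ℂ Y),
      y.compLeftContinuousBounded Ω (BoundedContinuousFunction.const Ω v) = 1 := by
  obtain ⟨v, hv⟩ := exists_ne (0 : Y)
  obtain ⟨y, -, hy⟩ := exists_dual_vector'' ℂ v
  have hv0 : (‖v‖ : ℂ) ≠ 0 := by simpa using hv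
  refine ⟨(‖v‖ : ℂ)⁻¹ • v, y, ?_⟩
  ext t
  change y ((‖v‖ : ℂ)⁻¹ • v) = 1
  rw [map_smul, hy, smul_eq_mul]
  exact inv_mul_cancel₀ hv0

end Ball

theorem mainTheorem7 :
    (∀ (Ω : Type*) [TopologicalSpace Ω] [T2Space Ω]
      (X : Type*) [NormedAddCommGroup X] [NormedSpace ℂ X] [CompleteSpace X]
      (S : Submodule ℂ (Ω →ᵇ X)) (A : Subalgebra ℂ (Ω →ᵇ ℂ)),
      IsFunctionSpaceOver S A → ¬ FiniteDimensional ℂ A → HasD2P S) ∧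
    (∀ (X : Type*) [NormedAddCommGroup X] [NormedSpace ℂ X] [CompleteSpace X] [Nontrivial X]
      (Y : Type*) [NormedAddCommGroup Y] [NormedSpace ℂ Y] [CompleteSpace Y] [Nontrivial Y],
      HasD2P (UnitBall X →ᵇ Y) ∧ HasD2P (HolBdd X Y) ∧ HasD2P (HolUnif X Y)) := by
  refine ⟨?_, ?_⟩
  · intro Ω _ _ X _ _ _ S A hS hA
    refine hasD2P_of_module S.subtypeₗᵢ A (fun e x => ?_) (fun φ hφ e => ?_) ?_ hA
    · rw [← SetLike.mem_coe, hS.base_eq]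
      exact ⟨e, e.2, x, fun _ => rfl⟩
    · exact ⟨⟨φ • (e : Ω →ᵇ X), hS.smul_mem φ hφ e e.2⟩, rfl⟩
    -- The constant `1` belongs to the base algebra, hence has the form `x* ∘ f`.
    · have h1 : (1 : Ω →ᵇ ℂ) ∈ baseSet S := by
        rw [← hS.base_eq]
        exact A.one_mem
      obtain ⟨f, hf, x, hx⟩ := h1
      exact ⟨⟨f, hf⟩, x, BoundedContinuousFunction.ext fun t => (hx t).symm⟩
  · intro X _ _ _ _ Y _ _ _ _
    obtain ⟨g, hg, hgr⟩ := exists_infinite_range (X := X)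
    obtain ⟨v, y, hvy⟩ := exists_comp_const_eq_one (UnitBall X) Y
    refine ⟨?_, ?_, ?_⟩
    · exact hasD2P_of_module LinearIsometry.id ⊤ (fun _ _ => trivial)
        (fun φ _ f => ⟨φ • f, rfl⟩) ⟨_, y, hvy⟩
        (not_finiteDimensional_of_infinite_range (g := g) trivial hgr)
    · exact hasD2P_of_module (HolBdd X Y).subtypeₗᵢ (holBddSubalgebra X)
        (fun f y => HolBdd.comp_mem f.2 y) (fun φ hφ f => ⟨⟨_, HolBdd.smul_mem hφ f.2⟩, rfl⟩)
        ⟨⟨_, (HolUnif.const_mem v).1⟩, y, hvy⟩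
        (not_finiteDimensional_of_infinite_range (g := g) hg.1 hgr)
    · exact hasD2P_of_module (HolUnif X Y).subtypeₗᵢ (holUnifSubalgebra X)
        (fun f y => HolUnif.comp_mem f.2 y) (fun φ hφ f => ⟨⟨_, HolUnif.smul_mem hφ f.2⟩, rfl⟩)
        ⟨⟨_, HolUnif.const_mem v⟩, y, hvy⟩
        (not_finiteDimensional_of_infinite_range (g := g) hg hgr)
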